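/- A hypergraph on a finite vertex set $X$ is a finite collection $\mathcal H$ of subsets of $X$ (its edges), with repeats allowed; here $\mathcal H$ is assumed to have at least one edge. For an integer $\ell\ge 0$, $\mathcal H$ is $\ell$-bounded if each of its edges has at most $\ell$ elements. For a real $\kappa>0$, $\mathcal H$ is $\kappa$-spread if, for every $S\subseteq X$, the number of edges of $\mathcal H$ that contain $S$ is at most $\kappa^{-|S|}|\mathcal H|$ (edges being counted with multiplicity on both sides). Let $(\xi_x)_{x\in X}$ be independent random variables, each uniform on $[0,1]$, and let $$\xi_{\mathcal H}=\min_{S\in\mathcal H}\ \sum_{x\in S}\xi_x .$$ **Theorem 1.7.** There are a universal constant $K>0$ and a function $\eta:\mathbb N\to\mathbb R$ with $\eta(\ell)\to 0$ as $\ell\to\infty$ such that, for every finite set $X$, every integer $\ell\ge 0$, every real $\kappa>0$ and every $\ell$-bounded, $\kappa$-spread hypergraph $\mathcal H$ on $X$ with at least one edge, $$\mathbb E[\xi_{\mathcal H}]\le \frac{K\ell}{\kappa}\qquad\text{and}\qquad \mathbb P\Big(\xi_{\mathcal H}\le \frac{K\ell}{\kappa}\Big)\ge 1-\eta(\ell).$$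 (That is, the second bound holds with probability tending to $1$ as $\ell\to\infty$, uniformly in $X$, $\kappa$ and $\mathcal H$.) -/

import Mathlib

open MeasureTheory ProbabilityTheory Filter Topology

/-- A hypergraph on the vertex set `X`: a finite collection of subsets of `X`, repeats allowed. -/
abbrev MultiHypergraph (X : Type*) := Multiset (Finset X)

namespace MultiHypergraph

variable {X : Type*}

/-- Every edge has at most `ℓ` elements. -/
def IsBounded (H : MultiHypergraph X) (ℓ : ℕ) : Prop :=
  ∀ S ∈ H, S.card ≤ ℓ

/-- `|H ∩ ⟨S⟩| ≤ κ^(-|S|) |H|` for every set `S` of vertices, where `H ∩ ⟨S⟩` is the collection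
of the edges that contain `S`; edges are counted with multiplicity on both sides. -/
def IsSpread [DecidableEq X] (H : MultiHypergraph X) (κ : ℝ) : Prop :=
  ∀ S : Finset X, ((H.filter (fun T => S ⊆ T)).card : ℝ) ≤ κ⁻¹ ^ S.card * (H.card : ℝ)

/-- The minimum, over the edges `S` of a hypergraph with at least one edge, of the total weight
`∑ x ∈ S, w x`. -/
noncomputable def minWeight [DecidableEq X] (H : MultiHypergraph X) (hH : H ≠ 0) (w : X → ℝ) : ℝ :=
  H.toFinset.inf' (Multiset.toFinset_nonempty.mpr hH) (fun S => ∑ x ∈ S, w x)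

end MultiHypergraph

/-! Call a weight cheap if it is at most p = 48² / κ, and let W be the p-random set of cheap
vertices. For an edge S, among the edges inside W ∪ S take S' with the fewest elements outside W; S'
\ W is the fragment of S. Paying at most ℓp for S', only the fragment is still to be covered.

Large fragments, with more than ℓ/2 elements, are rare. A pair (W, T) with T a fragment is
determined by Z = W ∪ T and T, and T lies in every edge inside Z, so a fixed Z leaves at most 2^ℓ
choices of T. Replacing W by Z costs p⁻¹ per element of T, and spreadness gives κ⁻¹ per element;
with pκ = q² the expected share of edges with a large fragment is at most (2/q)^ℓ
(`sum_subsetWeight_mul_card_largeFragmentEdges_le`). Hence, outside an event of probability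
4(2/q)^ℓ, the small fragments form an ℓ/2-bounded, (3/4)κ-spread hypergraph (`isSpread_residual`).

Given W, the relative positions of the weights in (0, p] or (p, 1] are again independent and uniform
(`uniformWeights_eq_sum`), so the argument repeats. Each round multiplies ℓ/κ by at most 2/3, so the
costs form a geometric series of order ℓ/κ. Induction on ℓ gives the expectation; for the
probability, about (log₂ ℓ)/2 rounds are run, with Markov's inequality at the end. -/

namespace MultiHypergraph

/-! ### Fragments of edges and the residual hypergraph -/

section EdgeInside

variable {X : Type*}

open Classical in
/-- An edge of `H` contained in `Z`, or the empty set when there is none. -/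
noncomputable def edgeInside (H : MultiHypergraph X) (Z : Finset X) : Finset X :=
  if h : ∃ S ∈ H, S ⊆ Z then h.choose else ∅

theorem card_edgeInside_le {H : MultiHypergraph X} {ℓ : ℕ} (hb : H.IsBounded ℓ) (Z : Finset X) :
    (H.edgeInside Z).card ≤ ℓ := by
  unfold edgeInside
  split_ifs with h
  · exact hb _ h.choose_spec.1
  · simp

end EdgeInside

section Fragments

variable {X : Type*} [DecidableEq X]

theorem exists_minimal_fragment (H : MultiHypergraph X) (W : Finset X) {S : Finset X}
    (hS : S ∈ H) :
    ∃ S' ∈ H, S' ⊆ W ∪ S ∧ ∀ R ∈ H, R ⊆ W ∪ S → (S' \ W).card ≤ (R \ W).card := by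
  have hne : (H.toFinset.filter (· ⊆ W ∪ S)).Nonempty :=
    ⟨S, by simp [hS]⟩
  obtain ⟨S', h1, h2⟩ := Finset.exists_min_image _ (fun R => (R \ W).card) hne
  simp only [Finset.mem_filter, Multiset.mem_toFinset] at h1 h2
  exact ⟨S', h1.1, h1.2, fun R hR hRW => h2 R ⟨hR, hRW⟩⟩

open Classical in
/-- The smallest set `S' \ W`, over the edges `S'` of `H` that are contained in `W ∪ S`. -/
noncomputable def fragment (H : MultiHypergraph X) (W S : Finset X) : Finset X :=
  if h : S ∈ H then (H.exists_minimal_fragment W h).choose \ W else ∅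

theorem fragment_spec (H : MultiHypergraph X) (W : Finset X) {S : Finset X} (hS : S ∈ H) :
    ∃ S' ∈ H, S' ⊆ W ∪ S ∧ H.fragment W S = S' \ W ∧
      ∀ R ∈ H, R ⊆ W ∪ S → (S' \ W).card ≤ (R \ W).card := by
  obtain ⟨h1, h2, h3⟩ := (H.exists_minimal_fragment W hS).choose_spec
  exact ⟨_, h1, h2, by simp [fragment, hS], h3⟩

theorem fragment_subset (H : MultiHypergraph X) (W : Finset X) {S : Finset X} (hS : S ∈ H) :
    H.fragment W S ⊆ S := by
  obtain ⟨S', _, h2, h3, _⟩ := H.fragment_spec W hS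
  rw [h3]
  intro x hx
  have := h2 (Finset.mem_sdiff.mp hx).1
  simp_all

theorem disjoint_fragment (H : MultiHypergraph X) (W : Finset X) {S : Finset X} (hS : S ∈ H) :
    Disjoint W (H.fragment W S) := by
  obtain ⟨S', _, _, h3, _⟩ := H.fragment_spec W hS
  rw [h3]
  exact Finset.disjoint_sdiff

/-- The fragment is contained in every edge covered by `W` together with the fragment. -/
theorem fragment_subset_of_subset (H : MultiHypergraph X) (W : Finset X) {S R : Finset X}
    (hS : S ∈ H) (hR : R ∈ H) (hRW : R ⊆ W ∪ H.fragment W S) : H.fragment W S ⊆ R := by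
  obtain ⟨S', _, _, h3, h4⟩ := H.fragment_spec W hS
  have hR' : R ⊆ W ∪ S := hRW.trans (Finset.union_subset_union_right (H.fragment_subset W hS))
  -- `R \ W` lies in the fragment, and minimality makes it at least as large, so the two coincide.
  have h5 : R \ W ⊆ H.fragment W S := by
    intro x hx
    have := hRW (Finset.mem_sdiff.mp hx).1
    simp_all
  have h6 : R \ W = H.fragment W S :=
    Finset.eq_of_subset_of_card_le h5 (by rw [h3]; exact h4 R hR hR')
  rw [← h6]
  exact Finset.sdiff_subset

/-- The right side depends only on the union, not on `W` or `S` separately; this is what limits the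
fragments compatible with a given union to 2^ℓ. -/
theorem fragment_subset_edgeInside (H : MultiHypergraph X) (W : Finset X) {S : Finset X}
    (hS : S ∈ H) : H.fragment W S ⊆ H.edgeInside (W ∪ H.fragment W S) := by
  have h : ∃ R ∈ H, R ⊆ W ∪ H.fragment W S := by
    obtain ⟨S', h1, _, h3, _⟩ := H.fragment_spec W hS
    exact ⟨S', h1, by rw [h3]; intro x hx; by_cases hxW : x ∈ W <;> simp [hx, hxW]⟩
  unfold edgeInside
  rw [dif_pos h]
  exact H.fragment_subset_of_subset W hS h.choose_spec.1 h.choose_spec.2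

theorem card_filter_le_sum (H : MultiHypergraph X) (q : Finset X → Prop) [DecidablePred q]
    (𝒯 : Finset (Finset X)) (h : ∀ S ∈ H, q S → ∃ T ∈ 𝒯, T ⊆ S) :
    (H.filter q).card ≤ ∑ T ∈ 𝒯, (H.filter (fun S => T ⊆ S)).card := by
  induction H using Multiset.induction_on with
  | empty => simp
  | cons S H ih =>
    have ih := ih fun R hR => h R (Multiset.mem_cons_of_mem hR)
    simp only [← Multiset.countP_eq_card_filter, Multiset.countP_cons, Finset.sum_add_distrib]
      at ih ⊢
    refine Nat.add_le_add ih ?_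
    split_ifs with hq
    · obtain ⟨T, hT, hTS⟩ := h S (Multiset.mem_cons_self _ _) hq
      exact le_trans (by simp [hTS])
        (Finset.single_le_sum (f := fun T => if T ⊆ S then 1 else 0) (fun _ _ => Nat.zero_le _) hT)
    · exact Nat.zero_le _

/-- The edges of `H` with a fragment of more than `ℓ / 2` elements. -/
noncomputable def largeFragmentEdges (H : MultiHypergraph X) (ℓ : ℕ) (W : Finset X) :
    MultiHypergraph X :=
  H.filter fun S => ℓ < 2 * (H.fragment W S).card

/-- The fragments with at most `ℓ / 2` elements. -/
noncomputable def residual (H : MultiHypergraph X) (ℓ : ℕ) (W : Finset X) : MultiHypergraph X :=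
  (H.filter fun S => ¬ ℓ < 2 * (H.fragment W S).card).map (H.fragment W)

theorem card_residual_add (H : MultiHypergraph X) (ℓ : ℕ) (W : Finset X) :
    (H.largeFragmentEdges ℓ W).card + (H.residual ℓ W).card = H.card := by
  unfold largeFragmentEdges residual
  rw [Multiset.card_map, ← Multiset.card_add, Multiset.filter_add_not]

theorem isBounded_residual (H : MultiHypergraph X) (ℓ : ℕ) (W : Finset X) :
    (H.residual ℓ W).IsBounded (ℓ / 2) := by
  intro T hT
  obtain ⟨S, hS, rfl⟩ := Multiset.mem_map.mp hT
  have := (Multiset.mem_filter.mp hS).2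
  omega

/-- Fragments lie in their edges, so passing to them does not increase the count of sets containing
`A`. Losing a quarter of the edges costs a factor 4/3, which for nonempty `A` is absorbed by
(4/3)^|A|; empty `A` is trivial. -/
theorem isSpread_residual {H : MultiHypergraph X} {κ : ℝ} (hκ : 0 < κ) (hs : H.IsSpread κ)
    {ℓ : ℕ} {W : Finset X} (hW : 4 * (H.largeFragmentEdges ℓ W).card ≤ H.card) :
    (H.residual ℓ W).IsSpread (3 / 4 * κ) := by
  intro A
  rcases A.eq_empty_or_nonempty with rfl | hA
  · simp
  have h1 : ((H.residual ℓ W).filter (fun T => A ⊆ T)).card ≤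
      (H.filter (fun T => A ⊆ T)).card := by
    unfold residual
    rw [Multiset.filter_map, Multiset.card_map, Multiset.filter_filter]
    have : ∀ S ∈ H, (A ⊆ H.fragment W S ∧ ¬ ℓ < 2 * (H.fragment W S).card) → A ⊆ S :=
      fun S hS h => h.1.trans (H.fragment_subset W hS)
    refine Multiset.card_le_card ?_
    rw [Multiset.le_filter]
    refine ⟨Multiset.filter_le _ _, fun S hS => ?_⟩
    obtain ⟨hS, h⟩ := Multiset.mem_filter.mp hS
    exact this S hS h
  have h2 : (H.card : ℝ) ≤ 4 / 3 * (H.residual ℓ W).card := by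
    have h3 : ((H.largeFragmentEdges ℓ W).card : ℝ) + (H.residual ℓ W).card = H.card := by
      exact_mod_cast H.card_residual_add ℓ W
    have h4 : 4 * ((H.largeFragmentEdges ℓ W).card : ℝ) ≤ H.card := by exact_mod_cast hW
    linarith
  have h5 : (4 / 3 : ℝ) ≤ (4 / 3) ^ A.card := le_self_pow₀ (by norm_num) hA.card_pos.ne'
  calc (((H.residual ℓ W).filter (fun T => A ⊆ T)).card : ℝ)
      ≤ (H.filter (fun T => A ⊆ T)).card := by exact_mod_cast h1
    _ ≤ κ⁻¹ ^ A.card * H.card := hs A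
    _ ≤ κ⁻¹ ^ A.card * ((4 / 3) ^ A.card * (H.residual ℓ W).card) := by
        gcongr
        exact h2.trans (by gcongr)
    _ = (3 / 4 * κ)⁻¹ ^ A.card * (H.residual ℓ W).card := by
        rw [← mul_assoc, ← mul_pow]
        congr 2
        field_simp

theorem residual_ne_zero {H : MultiHypergraph X} (hH : H ≠ 0) {ℓ : ℕ} {W : Finset X}
    (hW : 4 * (H.largeFragmentEdges ℓ W).card ≤ H.card) : H.residual ℓ W ≠ 0 := by
  intro h
  have h1 := H.card_residual_add ℓ W
  have h2 := Multiset.card_pos.mpr hH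
  rw [h, Multiset.card_zero] at h1
  omega

theorem minWeight_le (H : MultiHypergraph X) (hH : H ≠ 0) (w : X → ℝ) {S : Finset X}
    (hS : S ∈ H) : H.minWeight hH w ≤ ∑ x ∈ S, w x :=
  Finset.inf'_le _ (Multiset.mem_toFinset.mpr hS)

theorem exists_minWeight_eq (H : MultiHypergraph X) (hH : H ≠ 0) (w : X → ℝ) :
    ∃ S ∈ H, H.minWeight hH w = ∑ x ∈ S, w x := by
  obtain ⟨S, hS, h⟩ := Finset.exists_mem_eq_inf' (Multiset.toFinset_nonempty.mpr hH)
    (fun S => ∑ x ∈ S, w x)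
  exact ⟨S, Multiset.mem_toFinset.mp hS, h⟩

theorem minWeight_nonneg (H : MultiHypergraph X) (hH : H ≠ 0) {w : X → ℝ} (hw : ∀ x, 0 ≤ w x) :
    0 ≤ H.minWeight hH w := by
  obtain ⟨S, _, h⟩ := H.exists_minWeight_eq hH w
  rw [h]
  exact Finset.sum_nonneg fun x _ => hw x

theorem minWeight_le_mul {H : MultiHypergraph X} (hH : H ≠ 0) {ℓ : ℕ} (hb : H.IsBounded ℓ)
    {p : ℝ} (hp : 0 ≤ p) {v w : X → ℝ} (hw : ∀ x, w x ≤ p + v x) :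
    H.minWeight hH w ≤ ℓ * p + H.minWeight hH v := by
  obtain ⟨S, hS, h⟩ := H.exists_minWeight_eq hH v
  rw [h]
  calc H.minWeight hH w ≤ ∑ x ∈ S, w x := H.minWeight_le hH w hS
    _ ≤ ∑ x ∈ S, (p + v x) := Finset.sum_le_sum fun x _ => hw x
    _ = S.card * p + ∑ x ∈ S, v x := by simp [Finset.sum_add_distrib]
    _ ≤ ℓ * p + ∑ x ∈ S, v x := by
        gcongr
        exact_mod_cast hb S hS

/-- The optimal fragment extends to an edge `S'` by elements of `W`. Each element of `S'` pays at
most `p`, and only those outside `W` pay `v` as well. -/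
theorem minWeight_le_residual {H : MultiHypergraph X} (hH : H ≠ 0) {ℓ : ℕ} (hb : H.IsBounded ℓ)
    {p : ℝ} (hp : 0 ≤ p) {W : Finset X} (hR : H.residual ℓ W ≠ 0) {v w : X → ℝ}
    (hw : ∀ x, w x ≤ p + v x) (hwW : ∀ x ∈ W, w x ≤ p) :
    H.minWeight hH w ≤ ℓ * p + (H.residual ℓ W).minWeight hR v := by
  obtain ⟨T, hT, h⟩ := (H.residual ℓ W).exists_minWeight_eq hR v
  obtain ⟨S, hS, rfl⟩ := Multiset.mem_map.mp hT
  obtain ⟨S', h1, _, h3, _⟩ := H.fragment_spec W (Multiset.mem_filter.mp hS).1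
  rw [h, h3]
  calc H.minWeight hH w ≤ ∑ x ∈ S', w x := H.minWeight_le hH w h1
    _ ≤ ∑ x ∈ S', (p + if x ∈ W then 0 else v x) := by
        refine Finset.sum_le_sum fun x _ => ?_
        split_ifs with hx
        · simpa using hwW x hx
        · exact hw x
    _ = S'.card * p + ∑ x ∈ S' \ W, v x := by
        rw [Finset.sum_add_distrib, Finset.sdiff_eq_filter, Finset.sum_filter]
        simp
    _ ≤ ℓ * p + ∑ x ∈ S' \ W, v x := by
        gcongr
        exact_mod_cast hb S' h1

end Fragments

/-! ### Large fragments are rare for a random set -/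

section Counting

variable {X : Type*} [Fintype X] [DecidableEq X]

/-- The probability that a `p`-random subset of `X` equals `W`. -/
def subsetWeight (p : ℝ) (W : Finset X) : ℝ :=
  p ^ W.card * (1 - p) ^ Wᶜ.card

theorem subsetWeight_nonneg {p : ℝ} (h0 : 0 ≤ p) (h1 : p ≤ 1) (W : Finset X) :
    0 ≤ subsetWeight p W :=
  mul_nonneg (pow_nonneg h0 _) (pow_nonneg (sub_nonneg.mpr h1) _)

theorem sum_subsetWeight (p : ℝ) : ∑ W : Finset X, subsetWeight p W = 1 := by
  have := Finset.prod_add (fun _ : X => p) (fun _ => 1 - p) Finset.univ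
  simpa [subsetWeight, Finset.compl_eq_univ_sdiff] using this.symm

/-- Each element moved into the set gains a factor p and loses a factor 1 - p ≤ 1. -/
theorem subsetWeight_le_union {p : ℝ} (h0 : 0 < p) (h1 : p ≤ 1) {W T : Finset X}
    (h : Disjoint W T) : subsetWeight p W ≤ subsetWeight p (W ∪ T) * p⁻¹ ^ T.card := by
  unfold subsetWeight
  rw [Finset.card_union_of_disjoint h]
  have h2 : (1 - p) ^ Wᶜ.card ≤ (1 - p) ^ (W ∪ T)ᶜ.card :=
    pow_le_pow_of_le_one (by linarith) (by linarith)
      (Finset.card_le_card (Finset.compl_subset_compl.mpr Finset.subset_union_left))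
  calc p ^ W.card * (1 - p) ^ Wᶜ.card ≤ p ^ W.card * (1 - p) ^ (W ∪ T)ᶜ.card := by gcongr
    _ = _ := by
      rw [pow_add, inv_pow]
      field_simp

/-- The expected number of edges with a large fragment with respect to a `p`-random set. -/
theorem sum_subsetWeight_mul_card_largeFragmentEdges_le {H : MultiHypergraph X} {ℓ : ℕ} {κ p q : ℝ}
    (hκ : 0 < κ) (hb : H.IsBounded ℓ) (hs : H.IsSpread κ) (hp0 : 0 < p) (hp1 : p ≤ 1)
    (hq : 1 ≤ q) (hpq : p * κ = q ^ 2) :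
    ∑ W : Finset X, subsetWeight p W * (H.largeFragmentEdges ℓ W).card ≤
      (2 / q) ^ ℓ * H.card := by
  let 𝒯 : Finset X → Finset (Finset X) := fun W =>
    (H.toFinset.image (H.fragment W)).filter fun T => ℓ < 2 * T.card
  let 𝒰 : Finset X → Finset (Finset X) := fun Z =>
    (H.edgeInside Z).powerset.filter fun T => ℓ < 2 * T.card
  have key : ∑ W : Finset X, ∑ T ∈ 𝒯 W, subsetWeight p (W ∪ T) * (p * κ)⁻¹ ^ T.card ≤
      ∑ Z : Finset X, ∑ T ∈ 𝒰 Z, subsetWeight p Z * (p * κ)⁻¹ ^ T.card := by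
    rw [Finset.sum_sigma', Finset.sum_sigma']
    have hmem : ∀ a ∈ Finset.univ.sigma 𝒯, ∃ S ∈ H, H.fragment a.1 S = a.2 ∧ ℓ < 2 * a.2.card := by
      intro a ha
      simpa [𝒯, ← and_assoc] using ha
    -- A fragment is disjoint from `W`, so `W` is recovered as the union minus the fragment.
    have hinj : Set.InjOn (fun a : (_ : Finset X) × Finset X => (⟨a.1 ∪ a.2, a.2⟩ :
        (_ : Finset X) × Finset X)) (Finset.univ.sigma 𝒯 : Finset _) := by
      rintro ⟨W, T⟩ ha ⟨W', T'⟩ ha' h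
      obtain ⟨S, hS, hST, _⟩ := hmem _ ha
      obtain ⟨S', hS', hST', _⟩ := hmem _ ha'
      simp only [Sigma.mk.injEq, heq_eq_eq] at h hST hST' ⊢
      obtain ⟨h, rfl⟩ := h
      have hd := H.disjoint_fragment W hS
      have hd' := H.disjoint_fragment W' hS'
      rw [hST] at hd
      rw [hST'] at hd'
      refine ⟨?_, rfl⟩
      rw [← Finset.union_sdiff_cancel_right hd, h, Finset.union_sdiff_cancel_right hd']
    rw [← Finset.sum_image (f := fun a : (_ : Finset X) × Finset X =>
      subsetWeight p a.1 * (p * κ)⁻¹ ^ a.2.card) hinj]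
    refine Finset.sum_le_sum_of_subset_of_nonneg ?_ fun a _ _ =>
      mul_nonneg (subsetWeight_nonneg hp0.le hp1 _) (by positivity)
    intro b hb
    obtain ⟨a, ha, rfl⟩ := Finset.mem_image.mp hb
    obtain ⟨S, hS, hST, hl⟩ := hmem _ ha
    have := H.fragment_subset_edgeInside a.1 hS
    rw [hST] at this
    simp [𝒰, this, hl]
  have hterm : ∀ Z : Finset X, ∑ T ∈ 𝒰 Z, subsetWeight p Z * (p * κ)⁻¹ ^ T.card ≤
      subsetWeight p Z * (2 / q) ^ ℓ := by
    intro Z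
    rw [← Finset.mul_sum]
    refine mul_le_mul_of_nonneg_left ?_ (subsetWeight_nonneg hp0.le hp1 Z)
    have hq' : q⁻¹ ≤ 1 := inv_le_one_of_one_le₀ hq
    -- Since pκ = q², each term is q⁻¹ to the power 2|T|, and 2|T| > ℓ.
    calc ∑ T ∈ 𝒰 Z, (p * κ)⁻¹ ^ T.card ≤ ∑ T ∈ 𝒰 Z, q⁻¹ ^ ℓ := by
          refine Finset.sum_le_sum fun T hT => ?_
          have : ℓ < 2 * T.card := (Finset.mem_filter.mp hT).2
          rw [hpq, ← inv_pow, ← pow_mul]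
          exact pow_le_pow_of_le_one (by positivity) hq' this.le
      _ = (𝒰 Z).card * q⁻¹ ^ ℓ := by simp
      _ ≤ 2 ^ ℓ * q⁻¹ ^ ℓ := by
          gcongr
          have : (𝒰 Z).card ≤ 2 ^ ℓ := by
            refine (Finset.card_filter_le _ _).trans ?_
            rw [Finset.card_powerset]
            exact Nat.pow_le_pow_right two_pos (card_edgeInside_le hb Z)
          exact_mod_cast this
      _ = (2 / q) ^ ℓ := by rw [← mul_pow, div_eq_mul_inv]
  have hcard : ∀ W : Finset X, subsetWeight p W * ((H.largeFragmentEdges ℓ W).card : ℝ) ≤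
      (∑ T ∈ 𝒯 W, subsetWeight p (W ∪ T) * (p * κ)⁻¹ ^ T.card) * H.card := by
    intro W
    have h1 : ((H.largeFragmentEdges ℓ W).card : ℝ) ≤
        ∑ T ∈ 𝒯 W, ((H.filter (fun S => T ⊆ S)).card : ℝ) := by
      have := H.card_filter_le_sum (fun S => ℓ < 2 * (H.fragment W S).card) (𝒯 W) fun S hS hl =>
        ⟨H.fragment W S, by
          simp only [𝒯, Finset.mem_filter, Finset.mem_image, Multiset.mem_toFinset]
          exact ⟨⟨S, hS, rfl⟩, hl⟩, H.fragment_subset W hS⟩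
      unfold largeFragmentEdges
      exact_mod_cast this
    refine (mul_le_mul_of_nonneg_left h1 (subsetWeight_nonneg hp0.le hp1 W)).trans ?_
    rw [Finset.mul_sum, Finset.sum_mul]
    refine Finset.sum_le_sum fun T hT => ?_
    have hd : Disjoint W T := by
      simp only [𝒯, Finset.mem_filter, Finset.mem_image, Multiset.mem_toFinset] at hT
      obtain ⟨⟨S, hS, rfl⟩, _⟩ := hT
      exact H.disjoint_fragment W hS
    have hnn : 0 ≤ subsetWeight p (W ∪ T) * p⁻¹ ^ T.card :=
      mul_nonneg (subsetWeight_nonneg hp0.le hp1 _) (by positivity)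
    calc subsetWeight p W * ((H.filter (fun S => T ⊆ S)).card : ℝ)
        ≤ (subsetWeight p (W ∪ T) * p⁻¹ ^ T.card) * (κ⁻¹ ^ T.card * H.card) :=
          mul_le_mul (subsetWeight_le_union hp0 hp1 hd) (hs T) (Nat.cast_nonneg _) hnn
      _ = _ := by rw [mul_inv, mul_pow]; ring
  calc ∑ W : Finset X, subsetWeight p W * ((H.largeFragmentEdges ℓ W).card : ℝ)
      ≤ ∑ W : Finset X, (∑ T ∈ 𝒯 W, subsetWeight p (W ∪ T) * (p * κ)⁻¹ ^ T.card) * H.card :=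
        Finset.sum_le_sum fun W _ => hcard W
    _ = (∑ W : Finset X, ∑ T ∈ 𝒯 W, subsetWeight p (W ∪ T) * (p * κ)⁻¹ ^ T.card) * H.card := by
        rw [Finset.sum_mul]
    _ ≤ (∑ Z : Finset X, subsetWeight p Z * (2 / q) ^ ℓ) * H.card := by
        exact mul_le_mul_of_nonneg_right (key.trans (Finset.sum_le_sum fun Z _ => hterm Z))
          (Nat.cast_nonneg _)
    _ = (2 / q) ^ ℓ * H.card := by rw [← Finset.sum_mul, sum_subsetWeight, one_mul]

/-- With high probability at most a quarter of the edges have a large fragment. -/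
theorem sum_subsetWeight_largeFragmentEdges_le {H : MultiHypergraph X} (hH : H ≠ 0) {ℓ : ℕ}
    {κ p q : ℝ} (hκ : 0 < κ) (hb : H.IsBounded ℓ) (hs : H.IsSpread κ) (hp0 : 0 < p) (hp1 : p ≤ 1)
    (hq : 1 ≤ q) (hpq : p * κ = q ^ 2) :
    ∑ W : Finset X with ¬ 4 * (H.largeFragmentEdges ℓ W).card ≤ H.card, subsetWeight p W ≤
      4 * (2 / q) ^ ℓ := by
  have hpos : (0 : ℝ) < H.card := by exact_mod_cast Multiset.card_pos.mpr hH
  refine le_of_mul_le_mul_right ?_ hpos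
  have h := sum_subsetWeight_mul_card_largeFragmentEdges_le hκ hb hs hp0 hp1 hq hpq
  -- Markov's inequality for the number of edges with a large fragment.
  have h2 : (∑ W : Finset X with ¬ 4 * (H.largeFragmentEdges ℓ W).card ≤ H.card,
      subsetWeight p W) * H.card ≤
      4 * ∑ W : Finset X, subsetWeight p W * (H.largeFragmentEdges ℓ W).card := by
    rw [Finset.sum_mul, Finset.mul_sum]
    refine (Finset.sum_le_sum fun W hW => ?_).trans
      (Finset.sum_le_sum_of_subset_of_nonneg (Finset.filter_subset _ _) fun W _ _ =>
        mul_nonneg zero_le_four (mul_nonneg (subsetWeight_nonneg hp0.le hp1 W)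
          (Nat.cast_nonneg _)))
    have hW' : (H.card : ℝ) ≤ 4 * (H.largeFragmentEdges ℓ W).card := by
      exact_mod_cast (not_le.mp (Finset.mem_filter.mp hW).2).le
    nlinarith [subsetWeight_nonneg hp0.le hp1 W]
  linarith

end Counting

end MultiHypergraph

/-! ### Uniform weights as a mixture over the random set of cheap vertices -/

/-- The uniform distribution on the unit interval. -/
noncomputable abbrev uniformMeasure : Measure ℝ := volume.restrict (Set.Ioc 0 1)

instance : IsProbabilityMeasure uniformMeasure := ⟨by simp⟩

theorem volume_preimage_inter_Ioc {a : ℝ} (ha : 0 < a) (b : ℝ) (s : Set ℝ) :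
    volume ((fun u => b + a * u) ⁻¹' s ∩ Set.Ioc 0 1) =
      ENNReal.ofReal a⁻¹ * volume (s ∩ Set.Ioc b (b + a)) := by
  have h1 : (fun u => b + a * u) ⁻¹' s ∩ Set.Ioc 0 1 =
      (fun u => a * u) ⁻¹' ((fun y => b + y) ⁻¹' (s ∩ Set.Ioc b (b + a))) := by
    ext u
    simp only [Set.mem_inter_iff, Set.mem_preimage, Set.mem_Ioc, lt_add_iff_pos_right,
      add_le_add_iff_left, mul_pos_iff_of_pos_left ha, mul_le_iff_le_one_right ha]
  rw [h1, Real.volume_preimage_mul_left ha.ne', measure_preimage_add, abs_of_pos (inv_pos.mpr ha)]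

/-- The uniform distribution is the mixture of the uniform distributions on `(0, p]` and
`(p, 1]`. -/
theorem uniformMeasure_apply_eq_mixture {p : ℝ} (h0 : 0 < p) (h1 : p < 1) {s : Set ℝ}
    (hs : MeasurableSet s) :
    uniformMeasure s = ENNReal.ofReal p * uniformMeasure ((fun u => p * u) ⁻¹' s) +
      ENNReal.ofReal (1 - p) * uniformMeasure ((fun u => p + (1 - p) * u) ⁻¹' s) := by
  have hq : 0 < 1 - p := sub_pos.mpr h1
  have e1 := volume_preimage_inter_Ioc h0 0 s
  have e2 := volume_preimage_inter_Ioc hq p s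
  simp only [zero_add] at e1
  rw [Measure.restrict_apply hs,
    Measure.restrict_apply (hs.preimage (by fun_prop)),
    Measure.restrict_apply (hs.preimage (by fun_prop)), e1, e2, ← mul_assoc, ← mul_assoc,
    ← ENNReal.ofReal_mul h0.le, ← ENNReal.ofReal_mul hq.le, mul_inv_cancel₀ h0.ne',
    mul_inv_cancel₀ hq.ne', ENNReal.ofReal_one, one_mul, one_mul, add_sub_cancel,
    ← measure_union (Set.disjoint_left.mpr fun x hx hx' => not_lt.mpr hx.2.2 hx'.2.1)
      (hs.inter measurableSet_Ioc), ← Set.inter_union_distrib_left,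
    Set.Ioc_union_Ioc_eq_Ioc h0.le h1.le]

section Rescale

variable {X : Type*} [DecidableEq X]

/-- The weights below `p` are those of the elements of `W`, and `v` gives the relative positions
of the weights in their intervals. -/
def rescaleWeights (p : ℝ) (W : Finset X) (v : X → ℝ) : X → ℝ :=
  fun x => if x ∈ W then p * v x else p + (1 - p) * v x

theorem measurable_rescaleWeights (p : ℝ) (W : Finset X) : Measurable (rescaleWeights p W) := by
  refine measurable_pi_lambda _ fun x => ?_
  unfold rescaleWeights
  split_ifs <;> fun_prop

theorem rescaleWeights_nonneg {p : ℝ} (h0 : 0 ≤ p) (h1 : p ≤ 1) (W : Finset X) {v : X → ℝ}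
    (hv : ∀ x, 0 ≤ v x) (x : X) : 0 ≤ rescaleWeights p W v x := by
  have := hv x
  have h1' : 0 ≤ 1 - p := sub_nonneg.mpr h1
  unfold rescaleWeights
  split_ifs <;> positivity

theorem rescaleWeights_le_add {p : ℝ} (h0 : 0 ≤ p) (W : Finset X) {v : X → ℝ}
    (hv : ∀ x, 0 ≤ v x ∧ v x ≤ 1) (x : X) : rescaleWeights p W v x ≤ p + v x := by
  obtain ⟨h2, h3⟩ := hv x
  unfold rescaleWeights
  split_ifs <;> nlinarith

theorem rescaleWeights_le_of_mem {p : ℝ} (h0 : 0 ≤ p) {W : Finset X} {v : X → ℝ}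
    (hv : ∀ x, 0 ≤ v x ∧ v x ≤ 1) {x : X} (hx : x ∈ W) : rescaleWeights p W v x ≤ p := by
  rw [rescaleWeights, if_pos hx]
  exact mul_le_of_le_one_right h0 (hv x).2

end Rescale

section Mixture

variable {X : Type*} [Fintype X]

/-- The law of independent uniform weights. -/
noncomputable abbrev uniformWeights (X : Type*) [Fintype X] : Measure (X → ℝ) :=
  Measure.pi fun _ => uniformMeasure

theorem ae_uniformWeights : ∀ᵐ w ∂uniformWeights X, ∀ x, 0 ≤ w x ∧ w x ≤ 1 := by
  rw [ae_all_iff]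
  intro x
  have h : ∀ᵐ u ∂uniformMeasure, 0 ≤ u ∧ u ≤ 1 :=
    (ae_restrict_mem measurableSet_Ioc).mono fun u hu => ⟨hu.1.le, hu.2⟩
  exact (measurePreserving_eval (fun _ : X => uniformMeasure) x).quasiMeasurePreserving.ae h

variable [DecidableEq X]

/-- On boxes, this is the expansion of a product of two-term sums, one mixture per coordinate; `W`
records the coordinates where the lower interval is chosen. -/
theorem uniformWeights_eq_sum {p : ℝ} (h0 : 0 < p) (h1 : p < 1) :
    uniformWeights X = ∑ W : Finset X, ENNReal.ofReal (MultiHypergraph.subsetWeight p W) •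
      (uniformWeights X).map (rescaleWeights p W) := by
  refine Measure.pi_eq fun s hs => ?_
  simp only [Measure.coe_finsetSum, Finset.sum_apply, Measure.smul_apply, smul_eq_mul,
    Finset.prod_congr rfl fun x _ => uniformMeasure_apply_eq_mixture h0 h1 (hs x)]
  rw [Fintype.prod_add]
  refine Finset.sum_congr rfl fun W _ => ?_
  rw [Measure.map_apply (measurable_rescaleWeights p W) (.univ_pi hs)]
  have hpre : rescaleWeights p W ⁻¹' Set.univ.pi s = Set.univ.pi fun x =>
      if x ∈ W then (fun u => p * u) ⁻¹' s x else (fun u => p + (1 - p) * u) ⁻¹' s x := by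
    ext v
    simp only [Set.mem_preimage, Set.mem_univ_pi]
    refine forall_congr' fun x => ?_
    unfold rescaleWeights
    split_ifs <;> rfl
  rw [hpre, Measure.pi_pi, ← Finset.prod_mul_prod_compl W, Finset.prod_mul_distrib,
    Finset.prod_mul_distrib, Finset.prod_const, Finset.prod_const,
    Finset.prod_congr (g := fun x => uniformMeasure ((fun u => p * u) ⁻¹' s x)) rfl
      fun x hx => by rw [if_pos hx],
    Finset.prod_congr (s₁ := Wᶜ)
      (g := fun x => uniformMeasure ((fun u => p + (1 - p) * u) ⁻¹' s x)) rfl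
      fun x hx => by rw [if_neg (Finset.mem_compl.mp hx)],
    MultiHypergraph.subsetWeight, ENNReal.ofReal_mul (by positivity), ENNReal.ofReal_pow h0.le,
    ENNReal.ofReal_pow (by linarith)]
  ring

theorem integral_uniformWeights_eq_sum {p : ℝ} (h0 : 0 < p) (h1 : p < 1) {f : (X → ℝ) → ℝ}
    (hf : Measurable f) (hi : ∀ W, Integrable (fun v => f (rescaleWeights p W v))
      (uniformWeights X)) :
    ∫ w, f w ∂uniformWeights X = ∑ W : Finset X, MultiHypergraph.subsetWeight p W *
      ∫ v, f (rescaleWeights p W v) ∂uniformWeights X := by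
  conv_lhs => rw [uniformWeights_eq_sum h0 h1]
  rw [integral_finsetSum_measure]
  · refine Finset.sum_congr rfl fun W _ => ?_
    rw [integral_smul_measure, integral_map (measurable_rescaleWeights p W).aemeasurable
      hf.aestronglyMeasurable, ENNReal.toReal_ofReal
      (MultiHypergraph.subsetWeight_nonneg h0.le h1.le W), smul_eq_mul]
  · intro W _
    refine Integrable.smul_measure ?_ ENNReal.ofReal_ne_top
    rw [integrable_map_measure hf.aestronglyMeasurable
      (measurable_rescaleWeights p W).aemeasurable]
    exact hi W

theorem uniformWeights_real_eq_sum {p : ℝ} (h0 : 0 < p) (h1 : p < 1) {s : Set (X → ℝ)}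
    (hs : MeasurableSet s) :
    (uniformWeights X).real s = ∑ W : Finset X, MultiHypergraph.subsetWeight p W *
      (uniformWeights X).real (rescaleWeights p W ⁻¹' s) := by
  have h := integral_uniformWeights_eq_sum h0 h1 (f := s.indicator 1)
    (measurable_one.indicator hs) fun W => by
      have : (fun v => s.indicator (1 : (X → ℝ) → ℝ) (rescaleWeights p W v)) =
          (rescaleWeights p W ⁻¹' s).indicator 1 := rfl
      rw [this]
      exact (integrable_const (1 : ℝ)).indicator (hs.preimage (measurable_rescaleWeights p W))
  rw [integral_indicator_one hs] at h
  rw [h]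
  refine Finset.sum_congr rfl fun W _ => ?_
  rw [← integral_indicator_one (hs.preimage (measurable_rescaleWeights p W))]
  rfl

end Mixture

/-! ### Bounds for the expectation and the tail of the minimum weight -/

namespace MultiHypergraph

variable {X : Type*} [DecidableEq X]

theorem continuous_minWeight (H : MultiHypergraph X) (hH : H ≠ 0) :
    Continuous (H.minWeight hH) :=
  Continuous.finset_inf'_apply _ fun _ _ => by fun_prop

theorem minWeight_le_of_le_one {H : MultiHypergraph X} (hH : H ≠ 0) {ℓ : ℕ} (hb : H.IsBounded ℓ)
    {w : X → ℝ} (hw : ∀ x, w x ≤ 1) : H.minWeight hH w ≤ ℓ := by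
  obtain ⟨S, hS⟩ := Multiset.exists_mem_of_ne_zero hH
  calc H.minWeight hH w ≤ ∑ x ∈ S, w x := H.minWeight_le hH w hS
    _ ≤ ∑ x ∈ S, 1 := Finset.sum_le_sum fun x _ => hw x
    _ = S.card := by simp
    _ ≤ ℓ := by exact_mod_cast hb S hS

theorem minWeight_eq_zero {H : MultiHypergraph X} (hH : H ≠ 0) (hb : H.IsBounded 0)
    (w : X → ℝ) : H.minWeight hH w = 0 := by
  obtain ⟨S, hS, h⟩ := H.exists_minWeight_eq hH w
  rw [h, Finset.card_eq_zero.mp (Nat.le_zero.mp (hb S hS)), Finset.sum_empty]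

variable [Fintype X]

theorem integrable_minWeight (H : MultiHypergraph X) (hH : H ≠ 0) :
    Integrable (H.minWeight hH) (uniformWeights X) := by
  refine Integrable.of_bound (H.continuous_minWeight hH).aestronglyMeasurable
    (Fintype.card X : ℝ) ?_
  filter_upwards [ae_uniformWeights] with w hw
  rw [Real.norm_eq_abs, abs_of_nonneg (H.minWeight_nonneg hH fun x => (hw x).1)]
  exact minWeight_le_of_le_one hH (fun S _ => S.card_le_univ) fun x => (hw x).2

theorem integrable_minWeight_rescaleWeights (H : MultiHypergraph X) (hH : H ≠ 0) {p : ℝ}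
    (h0 : 0 ≤ p) (h1 : p ≤ 1) (W : Finset X) :
    Integrable (fun v => H.minWeight hH (rescaleWeights p W v)) (uniformWeights X) := by
  refine Integrable.mono' ((integrable_const (Fintype.card X * p)).add
    (H.integrable_minWeight hH)) ((H.continuous_minWeight hH).measurable.comp
      (measurable_rescaleWeights p W)).aestronglyMeasurable ?_
  filter_upwards [ae_uniformWeights] with v hv
  rw [Real.norm_eq_abs, abs_of_nonneg (H.minWeight_nonneg hH
    (rescaleWeights_nonneg h0 h1 W fun x => (hv x).1))]
  exact minWeight_le_mul hH (fun S _ => S.card_le_univ) h0 (rescaleWeights_le_add h0 W hv)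

/-- Splitting a sum over the random set according to the number of large fragments. -/
theorem sum_subsetWeight_mul_le {H : MultiHypergraph X} (hH : H ≠ 0) {ℓ : ℕ}
    {κ p q : ℝ} (hκ : 0 < κ) (hb : H.IsBounded ℓ) (hs : H.IsSpread κ) (hp0 : 0 < p) (hp1 : p ≤ 1)
    (hq : 1 ≤ q) (hpq : p * κ = q ^ 2) {g : Finset X → ℝ} {A B : ℝ} (hB : 0 ≤ B)
    (hgA : ∀ W, 4 * (H.largeFragmentEdges ℓ W).card ≤ H.card → g W ≤ A)
    (hgB : ∀ W, g W ≤ A + B) :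
    ∑ W : Finset X, subsetWeight p W * g W ≤ A + 4 * (2 / q) ^ ℓ * B := by
  have h := sum_subsetWeight_largeFragmentEdges_le hH hκ hb hs hp0 hp1 hq hpq
  calc ∑ W : Finset X, subsetWeight p W * g W
      ≤ ∑ W : Finset X, (subsetWeight p W * A +
          (if ¬ 4 * (H.largeFragmentEdges ℓ W).card ≤ H.card then subsetWeight p W else 0) * B) := by
        refine Finset.sum_le_sum fun W _ => ?_
        have hW := subsetWeight_nonneg hp0.le hp1 W
        by_cases hl : 4 * (H.largeFragmentEdges ℓ W).card ≤ H.card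
        · rw [if_neg (not_not.mpr hl), zero_mul, add_zero]
          exact mul_le_mul_of_nonneg_left (hgA W hl) hW
        · rw [if_pos hl, ← mul_add]
          exact mul_le_mul_of_nonneg_left (hgB W) hW
    _ = A + (∑ W : Finset X with ¬ 4 * (H.largeFragmentEdges ℓ W).card ≤ H.card,
          subsetWeight p W) * B := by
        rw [Finset.sum_add_distrib, ← Finset.sum_mul, ← Finset.sum_mul, sum_subsetWeight, one_mul,
          Finset.sum_filter]
    _ ≤ A + 4 * (2 / q) ^ ℓ * B := by gcongr

/-- On good `W` the induction hypothesis at (ℓ/2, 3κ/4) gives ℓp + 4ℓp. On bad `W` the only bound is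
ℓp + E, with E the unknown expectation itself, but their probability is at most 1/6. So E ≤ 5ℓp +
E/6, whence the constant 6. -/
theorem integral_minWeight_le {H : MultiHypergraph X} (hH : H ≠ 0) {ℓ : ℕ} {κ : ℝ} (hκ : 0 < κ)
    (hb : H.IsBounded ℓ) (hs : H.IsSpread κ) :
    ∫ w, H.minWeight hH w ∂uniformWeights X ≤ 6 * 48 ^ 2 * ℓ / κ := by
  induction ℓ using Nat.strong_induction_on generalizing H κ with
  | _ ℓ ih =>
  rcases Nat.eq_zero_or_pos ℓ with rfl | hℓ
  · simp [minWeight_eq_zero hH hb]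
  have hℓ' : (0 : ℝ) < ℓ := by exact_mod_cast hℓ
  set E := ∫ w, H.minWeight hH w ∂uniformWeights X with hE
  have hE0 : 0 ≤ E := by
    refine integral_nonneg_of_ae ?_
    filter_upwards [ae_uniformWeights] with w hw
    exact H.minWeight_nonneg hH fun x => (hw x).1
  rcases le_or_gt κ (48 ^ 2) with hκ' | hκ'
  -- Here 48² / κ ≥ 1 is no admissible probability, but the trivial bound ℓ suffices.
  · have h1 : E ≤ ℓ := by
      have : E ≤ ∫ _, (ℓ : ℝ) ∂uniformWeights X := by
        refine integral_mono_ae (H.integrable_minWeight hH) (integrable_const _) ?_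
        filter_upwards [ae_uniformWeights] with w hw
        exact minWeight_le_of_le_one hH hb fun x => (hw x).2
      simpa using this
    refine h1.trans ?_
    rw [le_div_iff₀ hκ]
    nlinarith
  set p : ℝ := 48 ^ 2 / κ with hp
  have hp0 : 0 < p := by positivity
  have hp1 : p < 1 := (div_lt_one hκ).mpr hκ'
  have hpκ : p * κ = 48 ^ 2 := by rw [hp]; field_simp
  have hbound : E ≤ (ℓ * p + 4 * p * ℓ) + 4 * (2 / 48) ^ ℓ * E := by
    refine (integral_uniformWeights_eq_sum hp0 hp1 (H.continuous_minWeight hH).measurable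
      (H.integrable_minWeight_rescaleWeights hH hp0.le hp1.le)).trans_le ?_
    refine sum_subsetWeight_mul_le hH hκ hb hs hp0 hp1.le (by norm_num) hpκ hE0
      (fun W hW => ?_) fun W => ?_
    · have hR := residual_ne_zero hH hW
      have h1 := ih (ℓ / 2) (Nat.div_lt_self hℓ one_lt_two) hR (by positivity)
        (H.isBounded_residual ℓ W) (isSpread_residual hκ hs hW)
      have h2 : ((ℓ / 2 : ℕ) : ℝ) ≤ ℓ / 2 := Nat.cast_div_le
      calc ∫ v, H.minWeight hH (rescaleWeights p W v) ∂uniformWeights X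
          ≤ ∫ v, (ℓ * p + (H.residual ℓ W).minWeight hR v) ∂uniformWeights X := by
            refine integral_mono_ae (H.integrable_minWeight_rescaleWeights hH hp0.le hp1.le W)
              ((integrable_const _).add (integrable_minWeight _ hR)) ?_
            filter_upwards [ae_uniformWeights] with v hv
            exact minWeight_le_residual hH hb hp0.le hR (rescaleWeights_le_add hp0.le W hv)
              fun x hx => rescaleWeights_le_of_mem hp0.le hv hx
        _ = ℓ * p + ∫ v, (H.residual ℓ W).minWeight hR v ∂uniformWeights X := by
            rw [integral_add (integrable_const _) (integrable_minWeight _ hR)]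
            simp
        _ ≤ ℓ * p + 6 * 48 ^ 2 * (ℓ / 2) / (3 / 4 * κ) := by
            gcongr
            exact h1.trans (by gcongr)
        _ = ℓ * p + 4 * p * ℓ := by rw [hp]; field_simp; norm_num
    · calc ∫ v, H.minWeight hH (rescaleWeights p W v) ∂uniformWeights X
          ≤ ∫ v, (ℓ * p + H.minWeight hH v) ∂uniformWeights X := by
            refine integral_mono_ae (H.integrable_minWeight_rescaleWeights hH hp0.le hp1.le W)
              ((integrable_const _).add (H.integrable_minWeight hH)) ?_
            filter_upwards [ae_uniformWeights] with v hv
            exact minWeight_le_mul hH hb hp0.le (rescaleWeights_le_add hp0.le W hv)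
        _ = ℓ * p + E := by
            rw [integral_add (integrable_const _) (H.integrable_minWeight hH)]
            simp [hE]
        _ ≤ ℓ * p + 4 * p * ℓ + E := by
            have : 0 ≤ 4 * p * ℓ := by positivity
            linarith
  have hδ : 4 * (2 / 48 : ℝ) ^ ℓ ≤ 1 / 6 := by
    have := pow_le_of_le_one (a := (2 / 48 : ℝ)) (by norm_num) (by norm_num) hℓ.ne'
    linarith
  have hfin : E ≤ 6 * p * ℓ := by nlinarith
  calc E ≤ 6 * p * ℓ := hfin
    _ = 6 * 48 ^ 2 * ℓ / κ := by rw [hp]; ring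

/-- Markov's inequality for the minimum weight. -/
theorem uniformWeights_real_minWeight_gt_le {H : MultiHypergraph X} (hH : H ≠ 0) {ℓ : ℕ} {κ y : ℝ}
    (hκ : 0 < κ) (hb : H.IsBounded ℓ) (hs : H.IsSpread κ) (hy : 0 < y) :
    (uniformWeights X).real {w | y / κ < H.minWeight hH w} ≤ 6 * 48 ^ 2 * ℓ / y := by
  have h := mul_meas_ge_le_integral_of_nonneg (μ := uniformWeights X) (f := H.minWeight hH)
    (by
      filter_upwards [ae_uniformWeights] with w hw
      exact H.minWeight_nonneg hH fun x => (hw x).1) (H.integrable_minWeight hH) (y / κ)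
  have h1 : (uniformWeights X).real {w | y / κ < H.minWeight hH w} ≤
      (uniformWeights X).real {w | y / κ ≤ H.minWeight hH w} :=
    measureReal_mono (Set.ofPred_subset_ofPred.mpr fun w hw => le_of_lt hw)
  have h2 := h.trans (integral_minWeight_le hH hκ hb hs)
  have hyκ : 0 < y / κ := by positivity
  refine h1.trans ?_
  rw [← le_div_iff₀' hyκ] at h2
  refine h2.trans_eq ?_
  field_simp

/-- Here n rounds are followed by Markov's inequality. The term 3 · 48² ℓ / κ is the sum of the
geometric series of costs ℓp with ratio 2/3. Replacing y by 3y/4 along with κ keeps y / κ fixed, so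
each round improves the final Markov bound by 2/3. The power of 2/48 is that of the smallest edge
bound reached, the worst over all rounds. -/
theorem uniformWeights_real_minWeight_gt_le_iterate {H : MultiHypergraph X} (hH : H ≠ 0) (n : ℕ)
    {ℓ : ℕ} {κ y : ℝ} (hκ : 0 < κ) (hb : H.IsBounded ℓ) (hs : H.IsSpread κ) (hy : 0 < y) :
    (uniformWeights X).real {w | (3 * 48 ^ 2 * ℓ + y) / κ < H.minWeight hH w} ≤
      4 * n * (2 / 48) ^ (ℓ / 2 ^ n) + (2 / 3) ^ n * (6 * 48 ^ 2 * ℓ / y) := by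
  induction n generalizing H ℓ κ y with
  | zero =>
    have h := uniformWeights_real_minWeight_gt_le hH hκ hb hs hy
    refine (measureReal_mono (Set.ofPred_subset_ofPred.mpr fun w hw => ?_)).trans (h.trans (by simp))
    refine lt_of_le_of_lt ?_ hw
    gcongr
    have : (0 : ℝ) ≤ 3 * 48 ^ 2 * ℓ := by positivity
    linarith
  | succ n ih =>
    rcases le_or_gt κ (48 ^ 2) with hκ' | hκ'
    · have h0 : (uniformWeights X).real {w | (3 * 48 ^ 2 * ℓ + y) / κ < H.minWeight hH w} = 0 := by
        rw [measureReal_eq_zero_iff, ← compl_compl {w | _ < H.minWeight hH w},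
          ← mem_ae_iff]
        filter_upwards [ae_uniformWeights] with w hw
        simp only [Set.mem_compl_iff, Set.mem_ofPred_eq, not_lt]
        refine (minWeight_le_of_le_one hH hb fun x => (hw x).2).trans ?_
        rw [le_div_iff₀ hκ]
        have : (0 : ℝ) ≤ ℓ := Nat.cast_nonneg _
        nlinarith
      rw [h0]
      positivity
    set p : ℝ := 48 ^ 2 / κ with hp
    have hp0 : 0 < p := by positivity
    have hp1 : p < 1 := (div_lt_one hκ).mpr hκ'
    have hpκ : p * κ = 48 ^ 2 := by rw [hp]; field_simp
    have hmeas : MeasurableSet {w | (3 * 48 ^ 2 * ℓ + y) / κ < H.minWeight hH w} :=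
      measurableSet_lt measurable_const (H.continuous_minWeight hH).measurable
    have h2 : ((ℓ / 2 : ℕ) : ℝ) ≤ ℓ / 2 := Nat.cast_div_le
    rw [uniformWeights_real_eq_sum hp0 hp1 hmeas]
    have hA : 0 ≤ 4 * (n : ℝ) * (2 / 48) ^ (ℓ / 2 ^ (n + 1)) +
      (2 / 3) ^ (n + 1) * (6 * 48 ^ 2 * ℓ / y) := by positivity
    refine (sum_subsetWeight_mul_le hH hκ hb hs hp0 hp1.le (by norm_num) hpκ zero_le_one
      (fun W hW => ?_) fun W => measureReal_le_one.trans (le_add_of_nonneg_left hA)).trans ?_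
    · have hR := residual_ne_zero hH hW
      have h1 := ih hR (y := 3 / 4 * y) (by positivity)
        (H.isBounded_residual ℓ W) (isSpread_residual hκ hs hW) (by positivity)
      rw [Nat.div_div_eq_div_mul, ← pow_succ'] at h1
      have h3 : (uniformWeights X).real (rescaleWeights p W ⁻¹'
          {w | (3 * 48 ^ 2 * ℓ + y) / κ < H.minWeight hH w}) ≤ (uniformWeights X).real
          {w | (3 * 48 ^ 2 * ((ℓ / 2 : ℕ) : ℝ) + 3 / 4 * y) / (3 / 4 * κ) <
            (H.residual ℓ W).minWeight hR w} := by
        refine ENNReal.toReal_mono (measure_ne_top _ _) (measure_mono_ae ?_)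
        filter_upwards [ae_uniformWeights] with v hv hlt
        have h4 := minWeight_le_residual hH hb hp0.le hR
          (rescaleWeights_le_add hp0.le W hv)
          fun x hx => rescaleWeights_le_of_mem hp0.le hv hx
        have h5 : (3 * 48 ^ 2 * ℓ + y) / κ < H.minWeight hH (rescaleWeights p W v) := hlt
        change _ < _
        have h6 : (3 * 48 ^ 2 * ((ℓ / 2 : ℕ) : ℝ) + 3 / 4 * y) / (3 / 4 * κ) ≤
            (3 * 48 ^ 2 * ((ℓ : ℝ) / 2) + 3 / 4 * y) / (3 / 4 * κ) := by gcongr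
        -- The residual threshold is the old one minus the cost ℓp of this round: 3 · 48² drops to 2
        -- · 48².
        have h7 : (3 * 48 ^ 2 * ((ℓ : ℝ) / 2) + 3 / 4 * y) / (3 / 4 * κ) =
            (3 * 48 ^ 2 * ℓ + y) / κ - ℓ * p := by
          rw [hp]
          field_simp
          ring
        linarith
      refine h3.trans (h1.trans ?_)
      refine add_le_add le_rfl ?_
      calc (2 / 3 : ℝ) ^ n * (6 * 48 ^ 2 * ((ℓ / 2 : ℕ) : ℝ) / (3 / 4 * y))
          ≤ (2 / 3 : ℝ) ^ n * (6 * 48 ^ 2 * (ℓ / 2) / (3 / 4 * y)) := by gcongr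
        _ = (2 / 3) ^ (n + 1) * (6 * 48 ^ 2 * ℓ / y) := by
          rw [pow_succ]
          field_simp
          ring
    · have h3 : (2 / 48 : ℝ) ^ ℓ ≤ (2 / 48) ^ (ℓ / 2 ^ (n + 1)) :=
        pow_le_pow_of_le_one (by norm_num) (by norm_num) (Nat.div_le_self _ _)
      push_cast
      linarith

end MultiHypergraph

/-! ### Transfer to random variables and choice of the number of rounds -/

/-- Independent uniform random variables have the law `uniformWeights`. -/
theorem map_eq_uniformWeights {X : Type*} [Fintype X] {Ω : Type*} [MeasurableSpace Ω]
    {P : Measure Ω} [IsProbabilityMeasure P] {ξ : X → Ω → ℝ} (hind : iIndepFun ξ P)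
    (hunif : ∀ x, pdf.IsUniform (ξ x) (Set.Icc 0 1) P volume) :
    AEMeasurable (fun ω x => ξ x ω) P ∧ P.map (fun ω x => ξ x ω) = uniformWeights X := by
  have hm : ∀ x, AEMeasurable (ξ x) P := fun x =>
    (hunif x).aemeasurable (by simp) (by simp)
  refine ⟨aemeasurable_pi_lambda _ hm, ?_⟩
  rw [(iIndepFun_iff_map_fun_eq_pi_map hm).mp hind]
  congr 1
  funext x
  -- The closed interval and the half-open one, which splits exactly at p, differ by a null set.
  rw [hunif x, ProbabilityTheory.cond, Real.volume_Icc, sub_zero, ENNReal.ofReal_one, inv_one,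
    one_smul, ← Measure.restrict_congr_set Ioc_ae_eq_Icc]

theorem tendsto_log_div_two_atTop : Tendsto (fun ℓ : ℕ => Nat.log 2 ℓ / 2) atTop atTop := by
  refine tendsto_atTop.mpr fun b => ?_
  filter_upwards [eventually_ge_atTop (2 ^ (2 * b))] with ℓ hℓ
  have := Nat.le_log_of_pow_le one_lt_two hℓ
  omega

/-- With n about half of log₂ ℓ, the edge bound after n halvings is still about √ℓ, hence at least
n, so the failure bound depends on n alone. -/
theorem le_div_two_pow_log {ℓ : ℕ} (hℓ : ℓ ≠ 0) :
    Nat.log 2 ℓ / 2 ≤ ℓ / 2 ^ (Nat.log 2 ℓ / 2) := by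
  rw [Nat.le_div_iff_mul_le (by positivity)]
  calc Nat.log 2 ℓ / 2 * 2 ^ (Nat.log 2 ℓ / 2)
      ≤ 2 ^ (Nat.log 2 ℓ / 2) * 2 ^ (Nat.log 2 ℓ / 2) := by
        gcongr
        exact Nat.lt_two_pow_self.le
    _ = 2 ^ (Nat.log 2 ℓ / 2 + Nat.log 2 ℓ / 2) := (pow_add _ _ _).symm
    _ ≤ 2 ^ Nat.log 2 ℓ := Nat.pow_le_pow_right two_pos (by omega)
    _ ≤ ℓ := Nat.pow_log_le_self 2 hℓ

theorem tendsto_failure_bound :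
    Tendsto (fun n : ℕ => 4 * n * (2 / 48 : ℝ) ^ n + (2 / 3) ^ n) atTop (𝓝 0) := by
  have h1 := (tendsto_self_mul_const_pow_of_lt_one (r := (2 / 48 : ℝ)) (by norm_num)
    (by norm_num)).const_mul 4
  have h2 := tendsto_pow_atTop_nhds_zero_of_lt_one (r := (2 / 3 : ℝ)) (by norm_num) (by norm_num)
  simpa [mul_assoc] using h1.add h2

theorem theorem1p7 :
    ∃ K : ℝ, 0 < K ∧ ∃ η : ℕ → ℝ, Tendsto η atTop (𝓝 0) ∧
      ∀ (X : Type*) [Fintype X] [DecidableEq X] (H : MultiHypergraph X) (hH : H ≠ 0)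
        (ℓ : ℕ) (κ : ℝ), 0 < κ → H.IsBounded ℓ → H.IsSpread κ →
      ∀ (Ω : Type*) [MeasurableSpace Ω] (P : Measure Ω) [IsProbabilityMeasure P]
        (ξ : X → Ω → ℝ), iIndepFun ξ P →
        (∀ x, pdf.IsUniform (ξ x) (Set.Icc 0 1) P volume) →
        Integrable (fun ω => H.minWeight hH (fun x => ξ x ω)) P ∧
        ∫ ω, H.minWeight hH (fun x => ξ x ω) ∂P ≤ K * ℓ / κ ∧
        1 - η ℓ ≤ P.real {ω | H.minWeight hH (fun x => ξ x ω) ≤ K * ℓ / κ} := by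
  refine ⟨9 * 48 ^ 2, by norm_num, fun ℓ => 4 * ((Nat.log 2 ℓ / 2 : ℕ) : ℝ) *
    (2 / 48) ^ (Nat.log 2 ℓ / 2) + (2 / 3) ^ (Nat.log 2 ℓ / 2),
    tendsto_failure_bound.comp tendsto_log_div_two_atTop, ?_⟩
  intro X _ _ H hH ℓ κ hκ hb hs Ω _ P _ ξ hind hunif
  obtain ⟨hm, hmap⟩ := map_eq_uniformWeights hind hunif
  have hcont := H.continuous_minWeight hH
  have hint : ∫ ω, H.minWeight hH (fun x => ξ x ω) ∂P =
      ∫ w, H.minWeight hH w ∂uniformWeights X := by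
    rw [← hmap, integral_map hm hcont.aestronglyMeasurable]
  refine ⟨?_, ?_, ?_⟩
  · have h := H.integrable_minWeight hH
    rw [← hmap, integrable_map_measure hcont.aestronglyMeasurable hm] at h
    exact h
  · rw [hint]
    refine (MultiHypergraph.integral_minWeight_le hH hκ hb hs).trans ?_
    gcongr
    norm_num
  · have hmeas : MeasurableSet {w | H.minWeight hH w ≤ 9 * 48 ^ 2 * ℓ / κ} :=
      measurableSet_le hcont.measurable measurable_const
    have hreal : P.real {ω | H.minWeight hH (fun x => ξ x ω) ≤ 9 * 48 ^ 2 * ℓ / κ} =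
        (uniformWeights X).real {w | H.minWeight hH w ≤ 9 * 48 ^ 2 * ℓ / κ} := by
      rw [← hmap, map_measureReal_apply_of_aemeasurable hm hmeas]
      rfl
    rw [hreal, ← compl_compl {w | H.minWeight hH w ≤ 9 * 48 ^ 2 * ℓ / κ},
      probReal_compl_eq_one_sub hmeas.compl, sub_le_sub_iff_left]
    have hset : {w | H.minWeight hH w ≤ 9 * 48 ^ 2 * ℓ / κ}ᶜ =
        {w | 9 * 48 ^ 2 * ℓ / κ < H.minWeight hH w} := by
      ext w
      simp
    rw [hset]
    -- For ℓ = 0 the choice of y below would vanish; the minimum weight is then 0.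
    rcases Nat.eq_zero_or_pos ℓ with rfl | hℓ
    · simp [MultiHypergraph.minWeight_eq_zero hH hb]
    have hℓ' : (0 : ℝ) < ℓ := by exact_mod_cast hℓ
    -- This y makes the Markov factor 1, and 3 + 6 = 9 gives K.
    have h := MultiHypergraph.uniformWeights_real_minWeight_gt_le_iterate hH (Nat.log 2 ℓ / 2)
      hκ hb hs (y := 6 * 48 ^ 2 * ℓ) (by positivity)
    rw [div_self (by positivity), mul_one,
      show 3 * 48 ^ 2 * (ℓ : ℝ) + 6 * 48 ^ 2 * ℓ = 9 * 48 ^ 2 * ℓ by ring] at h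
    refine h.trans ?_
    refine add_le_add (mul_le_mul_of_nonneg_left ?_ (by positivity)) le_rfl
    exact pow_le_pow_of_le_one (by norm_num) (by norm_num) (le_div_two_pow_log hℓ.ne')
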